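/- Let $(\Omega,\mathcal F,\mathbb P)$ be a probability space, $\mathcal G\subseteq\mathcal F$ a sub-$\sigma$-algebra and $N\ge 1$ an integer. Let $L^\infty(\mathbb R^N)$ be the space of essentially bounded $\mathcal F$-measurable random vectors $X=(X_1,\dots,X_N)^\top$, identified up to almost sure equality, and let $L^\infty_{\mathcal G}(\mathbb R^N)$ be the subspace of the $\mathcal G$-measurable ones; inequalities between random vectors are understood componentwise and almost surely. Let $r=(r_1,\dots,r_N)^\top\colon L^\infty(\mathbb R^N)\to L^\infty_{\mathcal G}(\mathbb R^N)$ be a vector-valued conditional risk measure, that is, a functional with the following three properties: - (monotonicity) $X\ge Y$ implies $r(X)\le r(Y)$, for all $X,Y\in L^\infty(\mathbb R^N)$; - (locality) $r(1_AX+1_{A^c}Y)=1_Ar(X)+1_{A^c}r(Y)$ for all $X,Y\in L^\infty(\mathbb R^N)$ and $A\in\mathcal G$; - (conditional marginal domination) for every $i\in\{1,\dots,N\}$ there is a functional $f_i\colon L^\infty_{\mathcal G}(\mathbb R)\to L^\infty_{\mathcal G}(\mathbb R)$ such that $r_i(m)\le f_i(m_i)$ for every $m\in L^\infty_{\mathcal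 G}(\mathbb R^N)$. Suppose moreover that $r$ is convex, i.e. $r(\lambda X+(1-\lambda)Y)\le\lambda r(X)+(1-\lambda)r(Y)$ for all $X,Y\in L^\infty(\mathbb R^N)$ and $\lambda\in(0,1)$, and that $r$ has the Fatou property, i.e. for every bounded sequence $(X^n)_{n\in\mathbb N}$ in $L^\infty(\mathbb R^N)$ that converges almost surely to some $X\in L^\infty(\mathbb R^N)$, one has $r_i(X)\le\liminf_{n\to\infty}r_i(X^n)$ for every $i\in\{1,\dots,N\}$. Then $r$ is conditionally separable: there exist functionals $\bar r_1,\dots,\bar r_N\colon L^\infty(\mathbb R)\to L^\infty_{\mathcal G}(\mathbb R)$ such that $r(X)=(\bar r_1(X_1),\dots,\bar r_N(X_N))^\top$ for every $X\in L^\infty(\mathbb R^N)$. -/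

import Mathlib

/-!
A convex function that is bounded above along a ray never exceeds its value at the origin of the
ray. Every `Z ∈ L^∞(ℝ^N)` dominates the deterministic vector `(-‖Z_j‖)_j`, so monotonicity and
marginal domination bound `r_i(Z)` above in terms of `Z_i` alone. Hence if `X_i = Y_i`, then `r_i`
is bounded above on the line through `X` and `Y`, all of whose points have the same `i`-th
component, and convexity forces `r_i(X) = r_i(Y)`.
-/

open MeasureTheory Filter Topology
open scoped ENNReal

noncomputable section

namespace CondRisk

variable {Ω : Type*}

/-- `L^∞(ℝ^N)`: essentially bounded random vectors, up to almost sure equality. The (in)equalities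
of `Lp` are the almost sure componentwise ones. -/
abbrev LInftyVec {mF : MeasurableSpace Ω} (N : ℕ) (P : Measure Ω) := Lp (Fin N → ℝ) ∞ P

/-- `L^∞(ℝ)`. -/
abbrev LInfty {mF : MeasurableSpace Ω} (P : Measure Ω) := Lp ℝ ∞ P

/-- `L^∞_𝒢(ℝ^N)`: the elements of `L^∞(ℝ^N)` that have a `𝒢`-measurable version. -/
abbrev LInftyVecG (N : ℕ) (mG : MeasurableSpace Ω) {mF : MeasurableSpace Ω} (P : Measure Ω) :=
  lpMeas (Fin N → ℝ) ℝ mG ∞ P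

/-- `L^∞_𝒢(ℝ)`. -/
abbrev LInftyG (mG : MeasurableSpace Ω) {mF : MeasurableSpace Ω} (P : Measure Ω) := lpMeas ℝ ℝ mG ∞ P

variable {N : ℕ} {mG mF : MeasurableSpace Ω} {P : Measure Ω}

/-- The `i`-th component `X_i` of `X ∈ L^∞(ℝ^N)`. -/
def comp (i : Fin N) (X : LInftyVec N P) : LInfty P :=
  (ContinuousLinearMap.proj (R := ℝ) (φ := fun _ : Fin N => ℝ) i).compLp X

theorem comp_coeFn (i : Fin N) (X : LInftyVec N P) : comp i X =ᵐ[P] fun ω => X ω i :=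
  ContinuousLinearMap.coeFn_compLp _ X

theorem comp_mem (i : Fin N) (X : LInftyVecG N mG P) :
    comp i (X : LInftyVec N P) ∈ lpMeas ℝ ℝ mG ∞ P := by
  rw [mem_lpMeas_iff_aestronglyMeasurable]
  have h : AEStronglyMeasurable[mG] (X : LInftyVec N P) P := lpMeas.aestronglyMeasurable X
  exact ((continuous_apply i).comp_aestronglyMeasurable h).congr (comp_coeFn i _).symm

/-- The `i`-th component of `X ∈ L^∞_𝒢(ℝ^N)`, an element of `L^∞_𝒢(ℝ)`. -/
def compG (i : Fin N) (X : LInftyVecG N mG P) : LInftyG mG P :=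
  ⟨comp i (X : LInftyVec N P), comp_mem i X⟩

/-- `1_A X + 1_{Aᶜ} Y`. -/
def paste {A : Set Ω} (hA : MeasurableSet[mF] A) (X Y : LInftyVec N P) : LInftyVec N P :=
  ((Lp.memLp X).indicator hA).toLp _ + ((Lp.memLp Y).indicator hA.compl).toLp _

theorem paste_coeFn {A : Set Ω} (hA : MeasurableSet[mF] A) (X Y : LInftyVec N P) :
    paste hA X Y =ᵐ[P] A.indicator X + Aᶜ.indicator Y :=
  (Lp.coeFn_add _ _).trans ((MemLp.coeFn_toLp _).add (MemLp.coeFn_toLp _))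

/-- Monotonicity. -/
def IsMonotone (r : LInftyVec N P → LInftyVecG N mG P) : Prop :=
  ∀ X Y : LInftyVec N P, Y ≤ X → (r X : LInftyVec N P) ≤ r Y

/-- Locality. -/
def IsLocal (hG : mG ≤ mF) (r : LInftyVec N P → LInftyVecG N mG P) : Prop :=
  ∀ (X Y : LInftyVec N P) (A : Set Ω) (hA : MeasurableSet[mG] A),
    (r (paste (hG A hA) X Y) : LInftyVec N P) = paste (hG A hA) (r X) (r Y)

/-- Conditional marginal domination property. -/
def HasCondMarginalDomination (r : LInftyVec N P → LInftyVecG N mG P) : Prop :=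
  ∀ i : Fin N, ∃ f : LInftyG mG P → LInftyG mG P, ∀ m : LInftyVecG N mG P,
    (compG i (r m) : LInfty P) ≤ f (compG i m)

/-- A vector-valued conditional risk measure. -/
structure IsCondRiskMeasure (hG : mG ≤ mF) (r : LInftyVec N P → LInftyVecG N mG P) : Prop where
  monotone : IsMonotone r
  isLocal : IsLocal hG r
  domination : HasCondMarginalDomination r

/-- Convexity. -/
def IsConvex (r : LInftyVec N P → LInftyVecG N mG P) : Prop :=
  ∀ (X Y : LInftyVec N P) (t : ℝ), 0 < t → t < 1 →
    (r (t • X + (1 - t) • Y) : LInftyVec N P) ≤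
      t • (r X : LInftyVec N P) + (1 - t) • (r Y : LInftyVec N P)

/-- Fatou property; the lower limit is taken in the extended reals. -/
def HasFatou (r : LInftyVec N P → LInftyVecG N mG P) : Prop :=
  ∀ (X : ℕ → LInftyVec N P) (X' : LInftyVec N P),
    (∃ C : ℝ, ∀ n, ‖X n‖ ≤ C) →
    (∀ᵐ ω ∂P, Tendsto (fun n => X n ω) atTop (𝓝 (X' ω))) →
    ∀ i : Fin N, ∀ᵐ ω ∂P,
      (((compG i (r X') : LInfty P) ω : ℝ) : EReal) ≤
        liminf (fun n => (((compG i (r (X n)) : LInfty P) ω : ℝ) : EReal)) atTop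

/-- Conditional separability. -/
def IsCondSeparable (r : LInftyVec N P → LInftyVecG N mG P) : Prop :=
  ∃ rbar : Fin N → LInfty P → LInftyG mG P,
    ∀ (X : LInftyVec N P) (i : Fin N), compG i (r X) = rbar i (comp i X)

end CondRisk

end

namespace CondRisk

section ConvexOn

variable {E F : Type*} [AddCommGroup E] [Module ℝ E] [AddCommGroup F] [PartialOrder F]
  [IsOrderedAddMonoid F] [Module ℝ F] [PosSMulMono ℝ F] [TopologicalSpace F]
  [ClosedIciTopology F] [ContinuousAdd F] [ContinuousSMul ℝ F]

theorem le_of_convexOn_of_forall_ray_le {f : E → F} (hf : ConvexOn ℝ Set.univ f) {x y : E} {c : F}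
    (hc : ∀ s : ℝ, 0 ≤ s → f (y + s • (x - y)) ≤ c) : f x ≤ f y := by
  have chord_le (t : ℝ) (ht : t ∈ Set.Ioo 0 1) : f x ≤ t • c + (1 - t) • f y := by
    have hx : t • (y + t⁻¹ • (x - y)) + (1 - t) • y = x := by
      rw [smul_add, smul_inv_smul₀ ht.1.ne']
      module
    calc f x = f (t • (y + t⁻¹ • (x - y)) + (1 - t) • y) := by rw [hx]
      _ ≤ t • f (y + t⁻¹ • (x - y)) + (1 - t) • f y :=
        hf.2 trivial trivial ht.1.le (sub_nonneg.2 ht.2.le) (add_sub_cancel t 1)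
      _ ≤ t • c + (1 - t) • f y := by
        gcongr
        exacts [ht.1.le, hc _ (inv_nonneg.2 ht.1.le)]
  have chord_tendsto : Tendsto (fun t : ℝ => t • c + (1 - t) • f y) (𝓝[>] 0) (𝓝 (f y)) := by
    have hcont : Continuous fun t : ℝ => t • c + (1 - t) • f y := by fun_prop
    exact (hcont.tendsto' 0 (f y) (by simp)).mono_left nhdsWithin_le_nhds
  exact ge_of_tendsto chord_tendsto (eventually_of_mem (Ioo_mem_nhdsGT one_pos) chord_le)

end ConvexOn

section Lp

variable {Ω E : Type*} {mG mF : MeasurableSpace Ω} {P : Measure Ω} [NormedAddCommGroup E]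

theorem ae_norm_le_norm (X : Lp E ∞ P) : ∀ᵐ ω ∂P, ‖X ω‖ ≤ ‖X‖ := by
  rw [Lp.norm_def, toReal_eLpNorm (Lp.aestronglyMeasurable X)]
  exact ae_le_lpNorm_exponent_top (Lp.memLp X)

instance instPosSMulMonoLp {𝕜 : Type*} [NormedRing 𝕜] [Preorder 𝕜] [PartialOrder E] [Module 𝕜 E]
    [IsBoundedSMul 𝕜 E] [PosSMulMono 𝕜 E] {p : ℝ≥0∞} : PosSMulMono 𝕜 (Lp E p P) where
  smul_le_smul_of_nonneg_left a ha X Y hXY := by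
    rw [← Lp.coeFn_le] at hXY ⊢
    filter_upwards [hXY, Lp.coeFn_smul a X, Lp.coeFn_smul a Y] with ω hω hX hY
    rw [hX, hY]
    exact smul_le_smul_of_nonneg_left hω ha

/-- The deterministic random variable with value `c`, as a `𝒢`-measurable element of `L^∞`. It is
defined for infinite measures too, unlike `MeasureTheory.Lp.const`. -/
noncomputable def constG [NormedSpace ℝ E] (mG : MeasurableSpace Ω) {_ : MeasurableSpace Ω}
    (P : Measure Ω) (c : E) : lpMeas E ℝ mG ∞ P :=
  ⟨(memLp_top_const c).toLp _, mem_lpMeas_iff_aestronglyMeasurable.2 <|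
    aestronglyMeasurable_const.congr (MemLp.coeFn_toLp (memLp_top_const c)).symm⟩

theorem constG_coeFn [NormedSpace ℝ E] (c : E) : (constG mG P c : Lp E ∞ P) =ᵐ[P] fun _ => c :=
  MemLp.coeFn_toLp (memLp_top_const c)

theorem constG_neg_norm_le (X : LInfty P) : (constG mG P (-‖X‖) : LInfty P) ≤ X := by
  rw [← Lp.coeFn_le]
  filter_upwards [constG_coeFn (mG := mG) (P := P) (-‖X‖), ae_norm_le_norm X] with ω hc hX
  rw [hc]
  exact neg_le_of_abs_le hX

end Lp

variable {Ω : Type*} {N : ℕ} {mG mF : MeasurableSpace Ω} {P : Measure Ω}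

/-- The `i`-th component `comp i` as a linear map, which makes the `map_*` lemmas available. -/
noncomputable def compₗ (i : Fin N) : LInftyVec N P →ₗ[ℝ] LInfty P :=
  (ContinuousLinearMap.proj (R := ℝ) (φ := fun _ : Fin N => ℝ) i).compLpₗ ∞ P

theorem compₗ_apply (i : Fin N) (X : LInftyVec N P) : compₗ i X = comp i X :=
  rfl

theorem le_iff_forall_comp_le {X Y : LInftyVec N P} : X ≤ Y ↔ ∀ i, comp i X ≤ comp i Y := by
  simp only [← Lp.coeFn_le]
  have hX : ∀ᵐ ω ∂P, ∀ i, comp i X ω = X ω i := ae_all_iff.2 fun i => comp_coeFn i X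
  have hY : ∀ᵐ ω ∂P, ∀ i, comp i Y ω = Y ω i := ae_all_iff.2 fun i => comp_coeFn i Y
  refine Iff.trans (eventually_congr ?_) ae_all_iff
  filter_upwards [hX, hY] with ω hXω hYω
  simp only [Pi.le_def, hXω, hYω]

theorem compG_constG (i : Fin N) (c : Fin N → ℝ) : compG i (constG mG P c) = constG mG P (c i) := by
  refine Subtype.ext (Lp.ext ?_)
  filter_upwards [comp_coeFn i (constG mG P c : LInftyVec N P), constG_coeFn (mG := mG) (P := P) c,
    constG_coeFn (mG := mG) (P := P) (c i)] with ω hcomp hc hci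
  rw [hci, compG, hcomp, hc]

variable {r : LInftyVec N P → LInftyVecG N mG P}

theorem IsConvex.convexOn_comp (hconv : IsConvex r) (i : Fin N) :
    ConvexOn ℝ Set.univ fun X => comp i (r X : LInftyVec N P) := by
  refine convexOn_iff_forall_pos.2 ⟨convex_univ, fun X _ Y _ a b ha hb hab => ?_⟩
  obtain rfl : b = 1 - a := eq_sub_of_add_eq' hab
  simpa only [← compₗ_apply, map_add, map_smul] using
    le_iff_forall_comp_le.1 (hconv X Y a ha (sub_pos.1 hb)) i

theorem HasCondMarginalDomination.exists_forall_comp_le (hdom : HasCondMarginalDomination r)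
    (hmono : IsMonotone r) (i : Fin N) :
    ∃ g : LInfty P → LInfty P, ∀ X, comp i (r X : LInftyVec N P) ≤ g (comp i X) := by
  obtain ⟨f, hf⟩ := hdom i
  refine ⟨fun x => f (constG mG P (-‖x‖)), fun X => ?_⟩
  let m : LInftyVecG N mG P := constG mG P fun j => -‖comp j X‖
  have hcomp (j : Fin N) : compG j m = constG mG P (-‖comp j X‖) := compG_constG j _
  have hmX : (m : LInftyVec N P) ≤ X := le_iff_forall_comp_le.2 fun j =>
    (congrArg Subtype.val (hcomp j)).trans_le (constG_neg_norm_le _)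
  calc comp i (r X : LInftyVec N P) ≤ compG i (r m) := le_iff_forall_comp_le.1 (hmono X m hmX) i
    _ ≤ f (compG i m) := hf m
    _ = f (constG mG P (-‖comp i X‖)) := by rw [hcomp i]

theorem IsConvex.comp_le_of_comp_eq (hconv : IsConvex r) (hmono : IsMonotone r)
    (hdom : HasCondMarginalDomination r) {i : Fin N} {X Y : LInftyVec N P}
    (hXY : comp i X = comp i Y) : comp i (r X : LInftyVec N P) ≤ comp i (r Y : LInftyVec N P) := by
  obtain ⟨g, hg⟩ := hdom.exists_forall_comp_le hmono i
  have hline (s : ℝ) : comp i (Y + s • (X - Y)) = comp i Y := by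
    simp only [← compₗ_apply] at hXY ⊢
    rw [map_add, map_smul, map_sub, hXY, sub_self, smul_zero, add_zero]
  refine le_of_convexOn_of_forall_ray_le (hconv.convexOn_comp i) (c := g (comp i Y)) fun s _ => ?_
  simpa only [hline] using hg (Y + s • (X - Y))

theorem IsConvex.factorsThrough_comp (hconv : IsConvex r) (hmono : IsMonotone r)
    (hdom : HasCondMarginalDomination r) (i : Fin N) :
    (fun X => compG i (r X)).FactorsThrough (comp i) := fun _ _ hXY =>
  Subtype.ext <| le_antisymm (hconv.comp_le_of_comp_eq hmono hdom hXY)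
    (hconv.comp_le_of_comp_eq hmono hdom hXY.symm)

end CondRisk

theorem mainTheorem3_general {Ω : Type*} {mG _ : MeasurableSpace Ω} {P : Measure Ω} {N : ℕ}
    {r : CondRisk.LInftyVec N P → CondRisk.LInftyVecG N mG P} (hmono : CondRisk.IsMonotone r)
    (hdom : CondRisk.HasCondMarginalDomination r) (hconv : CondRisk.IsConvex r) :
    CondRisk.IsCondSeparable r :=
  ⟨fun i => Function.extend (CondRisk.comp i) (fun X => CondRisk.compG i (r X)) 0,
    fun X i => ((hconv.factorsThrough_comp hmono hdom i).extend_apply 0 X).symm⟩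

theorem mainTheorem3 {Ω : Type*} (mG : MeasurableSpace Ω) {mF : MeasurableSpace Ω}
    (P : Measure Ω) [IsProbabilityMeasure P] (hG : mG ≤ mF) (N : ℕ)
    (r : CondRisk.LInftyVec N P → CondRisk.LInftyVecG N mG P)
    (hr : CondRisk.IsCondRiskMeasure hG r)
    (hconv : CondRisk.IsConvex r)
    (hfatou : CondRisk.HasFatou r) :
    CondRisk.IsCondSeparable r :=
  mainTheorem3_general hr.monotone hr.domination hconv
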